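/- Let $G=G_1\times\cdots\times G_l$ be a finite product of cyclic groups, each of which is either infinite or of prime power order, let $\omega:G\to\{\pm1\}$ be any homomorphism, and let $\widetilde{\mathbb Z}$ be the group $\mathbb Z$ with the $G$-action $g\cdot t=\omega(g)t$. Let $\wedge: H_m(G;\widetilde{\mathbb Z})\otimes H_n(G;\widetilde{\mathbb Z})\to H_{m+n}(G;\widetilde{\mathbb Z})$ be the Pontryagin product, that is, the product induced by the shuffle product on the bar complex of $G$ with coefficients in $\widetilde{\mathbb Z}$. Then: 1. $\wedge$ is strictly anticommutative: for all $m,n\ge 0$ and all $\mathfrak a\in H_m(G;\widetilde{\mathbb Z})$, $\mathfrak b\in H_n(G;\widetilde{\mathbb Z})$ one has $\mathfrak a\wedge\mathfrak b=(-1)^{mn}\,\mathfrak b\wedge\mathfrak a$, and $\mathfrak a\wedge\mathfrak a=0$ whenever $m$ is odd. 2. For every even $n>0$ and every $\mathfrak a\in H_n(G;\widetilde{\mathbb Z})$ there is $\mathfrak b\in H_{2n}(G;\widetilde{\mathbb Z})$ with $\mathfrak a\wedge\mathfrak a=2\mathfrak b$. -/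

import Mathlib

noncomputable section

namespace Pontryagin

open Finsupp CategoryTheory

variable {G : Type} [CommGroup G]

set_option linter.unusedSectionVars false

/-! ### The twisted integers -/

/-- The action of `G` on the integers through `ω : G → {±1}`, `g · t = ω(g) t`. -/
def twistedRepresentation (ω : G →* ℤˣ) : Representation ℤ G ℤ where
  toFun g := ((ω g : ℤˣ) : ℤ) • LinearMap.id
  map_one' := by ext; simp
  map_mul' g h := by ext; simp

/-- The `ℤ[G]`-module of integers twisted by `ω`. -/
abbrev twistedInt (ω : G →* ℤˣ) : Rep.{0} ℤ G := Rep.of (twistedRepresentation ω)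

/-- The homology group `H_n(G; ℤ̃)`, computed by the bar complex `C_n = ℤ[Gⁿ]`. -/
abbrev H (ω : G →* ℤˣ) (n : ℕ) : Type := groupHomology (twistedInt ω) n

/-! ### The shuffle product on bar words

A generator `[g₁|...|gₙ]` of the bar complex is encoded by the list `[g₁, ..., gₙ]`, and
`Word G` is the free abelian group on all such generators, of all degrees. -/

/-- The free abelian group on all bar generators `[g₁|...|gₙ]`, `n ≥ 0`. -/
abbrev Word (G : Type) : Type := List G →₀ ℤ

/-- Prefixing a bar generator by a letter. -/
def cons (a : G) : Word G →ₗ[ℤ] Word G := lmapDomain ℤ ℤ (List.cons a)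

/-- The signed sum of all shuffles of two bar generators, by recursion on which of the two words
supplies the first letter: `b` has to move past all `|x| + 1` letters of `a :: x`. -/
def shuffle : List G → List G → Word G
  | [], y => single y 1
  | a :: x, [] => single (a :: x) 1
  | a :: x, b :: y =>
      cons a (shuffle x (b :: y)) + (-1 : ℤ) ^ (x.length + 1) • cons b (shuffle (a :: x) y)
  termination_by x y => x.length + y.length

/-- The shuffle product, extended bilinearly. -/
def wordMul : Word G →ₗ[ℤ] Word G →ₗ[ℤ] Word G :=
  lsum (R := ℤ) ℤ fun x => LinearMap.toSpanSingleton ℤ _ (linearCombination ℤ (shuffle x))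

/-- The `n`-chains `ℤ[Gⁿ]` as a subgroup of all words. -/
def toWord (n : ℕ) : ((Fin n → G) →₀ ℤ) →ₗ[ℤ] Word G := lmapDomain ℤ ℤ List.ofFn

/-- The projection of a word to its component of degree `n`. -/
def ofWord (n : ℕ) : Word G →ₗ[ℤ] ((Fin n → G) →₀ ℤ) :=
  linearCombination ℤ fun x =>
    if h : x.length = n then single (fun i => x.get (i.cast h.symm)) 1 else 0

/-- The shuffle product of chains, `C_m × C_n → C_k`, where `k = m + n`. -/
def chainMul (m n k : ℕ) :
    ((Fin m → G) →₀ ℤ) →ₗ[ℤ] ((Fin n → G) →₀ ℤ) →ₗ[ℤ] ((Fin k → G) →₀ ℤ) :=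
  ((wordMul (G := G)).compl₁₂ (toWord m) (toWord n)).compr₂ (ofWord k)

/-! ### Elementary facts -/

lemma cons_single (a : G) (x : List G) (t : ℤ) : cons a (single x t) = single (a :: x) t := by
  simp [cons]

lemma toWord_single {n : ℕ} (g : Fin n → G) (t : ℤ) :
    toWord n (single g t) = single (List.ofFn g) t := by
  simp [toWord]

lemma ofWord_toWord (n : ℕ) (c : (Fin n → G) →₀ ℤ) : ofWord n (toWord n c) = c := by
  induction c using Finsupp.induction_linear with
  | zero => simp
  | add f g hf hg => simp [hf, hg]
  | single g t => simp [toWord_single, ofWord]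

lemma toWord_injective (n : ℕ) : Function.Injective (toWord (G := G) n) :=
  Function.LeftInverse.injective (ofWord_toWord n)

lemma single_mem_range {x : List G} {n : ℕ} (h : x.length = n) (t : ℤ) :
    single x t ∈ LinearMap.range (toWord (G := G) n) := by
  subst h
  exact ⟨single x.get t, by simp [toWord_single]⟩

lemma cons_mem_range {n : ℕ} (a : G) {z : Word G} (hz : z ∈ LinearMap.range (toWord (G := G) n)) :
    cons a z ∈ LinearMap.range (toWord (G := G) (n + 1)) := by
  obtain ⟨c, rfl⟩ := hz
  induction c using Finsupp.induction_linear with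
  | zero => simp
  | add f g hf hg => simpa using Submodule.add_mem _ hf hg
  | single g t =>
    rw [toWord_single, cons_single]
    exact single_mem_range (by simp) t

lemma shuffle_nil_left (y : List G) : shuffle [] y = single y 1 := by
  rw [shuffle]

lemma shuffle_nil_right (x : List G) : shuffle x [] = single x 1 := by
  cases x <;> rw [shuffle]

lemma shuffle_cons_cons (a b : G) (x y : List G) :
    shuffle (a :: x) (b :: y) =
      cons a (shuffle x (b :: y)) + (-1 : ℤ) ^ (x.length + 1) • cons b (shuffle (a :: x) y) := by
  rw [shuffle]

lemma shuffle_mem_range (x y : List G) :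
    shuffle x y ∈ LinearMap.range (toWord (G := G) (x.length + y.length)) := by
  induction x, y using shuffle.induct with
  | case1 y => rw [shuffle_nil_left]; exact single_mem_range (by simp) _
  | case2 a x => rw [shuffle_nil_right]; exact single_mem_range (by simp) _
  | case3 a x b y ih1 ih2 =>
    rw [shuffle_cons_cons]
    refine Submodule.add_mem _ ?_ (Submodule.smul_mem _ _ ?_)
    · have h := cons_mem_range a ih1
      rwa [show x.length + (b :: y).length + 1 = (a :: x).length + (b :: y).length by
        simp only [List.length_cons]; omega] at h
    · exact cons_mem_range b ih2

lemma wordMul_single (x y : List G) (s t : ℤ) :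
    wordMul (single x s) (single y t) = (s * t) • shuffle x y := by
  simp [wordMul, mul_smul, smul_comm s t]

lemma wordMul_mem_range {m n k : ℕ} (h : m + n = k) (c : (Fin m → G) →₀ ℤ)
    (d : (Fin n → G) →₀ ℤ) :
    wordMul (toWord m c) (toWord n d) ∈ LinearMap.range (toWord (G := G) k) := by
  induction c using Finsupp.induction_linear with
  | zero => simp
  | add f g hf hg => simpa using Submodule.add_mem _ hf hg
  | single g s =>
    induction d using Finsupp.induction_linear with
    | zero => simp
    | add f g hf hg => simpa using Submodule.add_mem _ hf hg
    | single g' t =>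
      rw [toWord_single, toWord_single, wordMul_single]
      refine Submodule.smul_mem _ _ ?_
      have := shuffle_mem_range (List.ofFn g) (List.ofFn g')
      rw [List.length_ofFn, List.length_ofFn, h] at this
      exact this

lemma toWord_chainMul {m n k : ℕ} (h : m + n = k) (c : (Fin m → G) →₀ ℤ)
    (d : (Fin n → G) →₀ ℤ) :
    toWord k (chainMul m n k c d) = wordMul (toWord m c) (toWord n d) := by
  obtain ⟨e, he⟩ := wordMul_mem_range h c d
  simp [chainMul, ← he, ofWord_toWord]

/-! ### The Leibniz rule for the bar differential -/

/-- `[g₁|...|gₙ] ↦ ω(g₁) [g₂|...|gₙ]`, and `[] ↦ 0`. -/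
def frontFace (ω : G →* ℤˣ) : Word G →ₗ[ℤ] Word G :=
  linearCombination ℤ fun x =>
    match x with
    | [] => 0
    | a :: x => single x ((ω a : ℤˣ) : ℤ)

/-- `[g₁|...|gₙ] ↦ [a g₁|...|gₙ]`, and `[] ↦ []`. -/
def headMul (a : G) : Word G →ₗ[ℤ] Word G :=
  linearCombination ℤ fun x =>
    match x with
    | [] => single [] 1
    | b :: x => single ((a * b) :: x) 1

/-- The alternating sum of the faces other than the first, on a generator. -/
def restAux : List G → Word G
  | [] => 0
  | a :: x => - headMul a (single x 1) - cons a (restAux x)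

/-- The alternating sum of the faces other than the first. -/
def restFaces : Word G →ₗ[ℤ] Word G := linearCombination ℤ restAux

/-- The differential of the bar complex, on words. -/
def wordBoundary (ω : G →* ℤˣ) : Word G →ₗ[ℤ] Word G := frontFace ω + restFaces

/-- The sign `(-1)ⁿ` in degree `n`. -/
def degSign : Word G →ₗ[ℤ] Word G := linearCombination ℤ fun x => single x ((-1 : ℤ) ^ x.length)

lemma degSign_single (x : List G) (t : ℤ) :
    degSign (single x t) = (-1 : ℤ) ^ x.length • single x t := by
  simp [degSign, mul_comm]

lemma frontFace_nil (ω : G →* ℤˣ) (t : ℤ) : frontFace ω (single [] t) = 0 := by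
  simp [frontFace]

lemma frontFace_cons (ω : G →* ℤˣ) (a : G) (z : Word G) :
    frontFace ω (cons a z) = ((ω a : ℤˣ) : ℤ) • z := by
  induction z using Finsupp.induction_linear with
  | zero => simp
  | add f g hf hg => simp [hf, hg]
  | single x t => simp [cons_single, frontFace, mul_comm]

lemma headMul_nil (a : G) (t : ℤ) : headMul a (single [] t) = single [] t := by
  simp [headMul]

lemma headMul_cons (a b : G) (z : Word G) : headMul a (cons b z) = cons (a * b) z := by
  induction z using Finsupp.induction_linear with
  | zero => simp
  | add f g hf hg => simp [hf, hg]
  | single x t => simp [cons_single, headMul]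

lemma restFaces_nil (t : ℤ) : restFaces (single ([] : List G) t) = 0 := by
  simp [restFaces, restAux]

lemma restFaces_cons (a : G) (z : Word G) :
    restFaces (cons a z) = - headMul a z - cons a (restFaces z) := by
  induction z using Finsupp.induction_linear with
  | zero => simp
  | add f g hf hg => simp only [map_add, hf, hg]; abel
  | single x t =>
    have : single x t = t • single x (1 : ℤ) := by simp
    rw [this]
    simp only [map_smul, cons_single]
    rw [← smul_neg, ← smul_sub]
    simp [restFaces, restAux]

lemma degSign_cons (a : G) (z : Word G) : degSign (cons a z) = - cons a (degSign z) := by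
  induction z using Finsupp.induction_linear with
  | zero => simp
  | add f g hf hg => simp only [map_add, hf, hg]; abel
  | single x t => simp only [cons_single, degSign_single, List.length_cons, pow_succ,
      mul_neg, mul_one, neg_smul, map_smul]

lemma degSign_headMul (a : G) (z : Word G) : degSign (headMul a z) = headMul a (degSign z) := by
  induction z using Finsupp.induction_linear with
  | zero => simp
  | add f g hf hg => simp only [map_add, hf, hg]
  | single x t =>
    cases x with
    | nil => simp [headMul_nil, degSign_single]
    | cons b x => rw [← cons_single, headMul_cons, degSign_cons, degSign_cons, map_neg,
        headMul_cons]

lemma degSign_restFaces_single (x : List G) (t : ℤ) :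
    degSign (restFaces (single x t)) = - restFaces (degSign (single x t)) := by
  induction x with
  | nil => simp [restFaces_nil, degSign_single]
  | cons a x ih =>
    rw [← cons_single, restFaces_cons, degSign_cons, map_neg, restFaces_cons, map_sub, map_neg,
      degSign_headMul, degSign_cons, ih]
    simp only [map_neg]
    abel

lemma wordMul_nil_left (z : Word G) : wordMul (single [] 1) z = z := by
  induction z using Finsupp.induction_linear with
  | zero => simp
  | add f g hf hg => simp only [map_add, hf, hg]
  | single x t => simp [wordMul_single, shuffle_nil_left]

lemma wordMul_nil_right (z : Word G) : wordMul z (single [] 1) = z := by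
  induction z using Finsupp.induction_linear with
  | zero => simp
  | add f g hf hg => simp only [map_add, LinearMap.add_apply, hf, hg]
  | single x t => simp [wordMul_single, shuffle_nil_right]

lemma wordMul_cons_cons (a b : G) (z w : Word G) :
    wordMul (cons a z) (cons b w) =
      cons a (wordMul z (cons b w)) - cons b (wordMul (cons a (degSign z)) w) := by
  induction z using Finsupp.induction_linear with
  | zero => simp
  | add f g hf hg => simp only [map_add, LinearMap.add_apply, hf, hg]; abel
  | single x s =>
    induction w using Finsupp.induction_linear with
    | zero => simp
    | add f g hf hg => simp only [map_add, hf, hg]; abel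
    | single y t =>
      simp only [cons_single, degSign_single, wordMul_single, map_smul, LinearMap.smul_apply,
        shuffle_cons_cons, smul_add, pow_succ, mul_neg, mul_one, neg_smul, smul_neg]
      rw [smul_comm (s * t) ((-1 : ℤ) ^ x.length), ← sub_eq_add_neg]

lemma single_cons (a : G) (x : List G) : single (a :: x) (1 : ℤ) = cons a (single x 1) :=
  (cons_single a x 1).symm

lemma headMul_wordMul_left (a b : G) (z w : Word G) :
    headMul a (wordMul z (cons b w)) = wordMul (headMul a z) (cons b w)
      + cons (a * b) (wordMul (degSign z) w) - cons b (wordMul (headMul a (degSign z)) w) := by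
  induction z using Finsupp.induction_linear with
  | zero => simp
  | add f g hf hg => simp only [map_add, LinearMap.add_apply, hf, hg]; abel
  | single x s =>
    have hs : single x s = s • single x (1 : ℤ) := by simp
    rw [hs]
    simp only [map_smul, LinearMap.smul_apply, ← smul_sub, ← smul_add]
    congr 1
    cases x with
    | nil => simp [headMul_nil, degSign_single, wordMul_nil_left, headMul_cons]
    | cons c x =>
      rw [single_cons]
      simp only [headMul_cons, degSign_cons, wordMul_cons_cons, map_sub, map_neg,
        LinearMap.neg_apply]
      abel

lemma headMul_wordMul_right (a b : G) (z w : Word G) :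
    headMul b (wordMul (cons a z) w) = wordMul (cons a z) (headMul b w)
      - cons a (wordMul z (headMul b w)) + cons (b * a) (wordMul z w) := by
  induction w using Finsupp.induction_linear with
  | zero => simp
  | add f g hf hg => simp only [map_add, hf, hg]; abel
  | single y s =>
    have hs : single y s = s • single y (1 : ℤ) := by simp
    rw [hs]
    simp only [map_smul, ← smul_sub, ← smul_add]
    congr 1
    cases y with
    | nil => simp [headMul_nil, wordMul_nil_right, headMul_cons]
    | cons c y =>
      rw [single_cons]
      simp only [headMul_cons, wordMul_cons_cons, map_sub]
      abel

lemma frontFace_shuffle (ω : G →* ℤˣ) (x y : List G) :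
    frontFace ω (wordMul (single x 1) (single y 1)) =
      wordMul (frontFace ω (single x 1)) (single y 1)
        + wordMul (degSign (single x 1)) (frontFace ω (single y 1)) := by
  cases x with
  | nil => simp [frontFace_nil, wordMul_nil_left, degSign_single]
  | cons a x =>
    cases y with
    | nil => simp [frontFace_nil, wordMul_nil_right]
    | cons b y =>
      simp only [single_cons, wordMul_cons_cons, map_sub, frontFace_cons, degSign_cons, map_smul,
        LinearMap.smul_apply, map_neg, LinearMap.neg_apply, smul_neg]
      abel

lemma restFaces_shuffle (x y : List G) :
    restFaces (wordMul (single x 1) (single y 1)) =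
      wordMul (restFaces (single x 1)) (single y 1)
        + wordMul (degSign (single x 1)) (restFaces (single y 1)) := by
  induction x, y using shuffle.induct with
  | case1 y => simp [restFaces_nil, wordMul_nil_left, degSign_single]
  | case2 a x => simp [restFaces_nil, wordMul_nil_right]
  | case3 a x b y ih1 ih2 =>
    have hd : cons a (degSign (single x 1)) = (-1 : ℤ) ^ x.length • cons a (single x (1 : ℤ)) := by
      rw [degSign_single, map_smul]
    have ih2' : restFaces (wordMul (cons a (degSign (single x 1))) (single y 1)) =
        wordMul (restFaces (cons a (degSign (single x 1)))) (single y 1)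
        + wordMul (degSign (cons a (degSign (single x 1)))) (restFaces (single y 1)) := by
      rw [hd]
      simp only [map_smul, LinearMap.smul_apply, ← smul_add]
      rw [cons_single, ih2]
    simp only [single_cons, wordMul_cons_cons, map_sub, restFaces_cons] at ih1 ⊢
    rw [ih1, ih2']
    have hdd : degSign (degSign (single x (1 : ℤ))) = single x 1 := by
      simp [degSign_single, ← mul_pow]
    simp only [map_sub, map_neg, map_add, LinearMap.neg_apply, LinearMap.sub_apply,
      restFaces_cons, degSign_cons, hdd, wordMul_cons_cons,
      headMul_wordMul_left, headMul_wordMul_right, degSign_restFaces_single, mul_comm b a]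
    abel

/-- The Leibniz rule `∂(z ∧ w) = ∂z ∧ w + (-1)^|z| z ∧ ∂w`. -/
lemma wordBoundary_wordMul (ω : G →* ℤˣ) (z w : Word G) :
    wordBoundary ω (wordMul z w) =
      wordMul (wordBoundary ω z) w + wordMul (degSign z) (wordBoundary ω w) := by
  induction z using Finsupp.induction_linear with
  | zero => simp
  | add f g hf hg => simp only [map_add, LinearMap.add_apply, hf, hg]; abel
  | single x s =>
    induction w using Finsupp.induction_linear with
    | zero => simp
    | add f g hf hg => simp only [map_add, hf, hg]; abel
    | single y t =>
      have hs : single x s = s • single x (1 : ℤ) := by simp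
      have ht : single y t = t • single y (1 : ℤ) := by simp
      rw [hs, ht]
      simp only [map_smul, LinearMap.smul_apply, ← smul_add]
      congr 2
      simp only [wordBoundary, LinearMap.add_apply, map_add, frontFace_shuffle, restFaces_shuffle]
      abel

lemma degSign_toWord (n : ℕ) (c : (Fin n → G) →₀ ℤ) :
    degSign (toWord n c) = (-1 : ℤ) ^ n • toWord n c := by
  induction c using Finsupp.induction_linear with
  | zero => simp
  | add f g hf hg => simp only [map_add, smul_add, hf, hg]
  | single g t => rw [toWord_single, degSign_single, List.length_ofFn]

/-! ### Comparison with the differential of the complex of inhomogeneous chains -/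

lemma contractNth_zero_ofFn (n : ℕ) (g : Fin (n + 2) → G) :
    List.ofFn (Fin.contractNth 0 (· * ·) g) =
      (g 0 * g 1) :: List.ofFn (fun i : Fin n => g i.succ.succ) := by
  rw [List.ofFn_succ]
  rfl

lemma contractNth_succ_ofFn (n : ℕ) (g : Fin (n + 2) → G) (j : Fin (n + 1)) :
    List.ofFn (Fin.contractNth j.succ (· * ·) g) =
      g 0 :: List.ofFn (Fin.contractNth j (· * ·) (fun i => g i.succ)) := by
  rw [List.ofFn_succ]
  congr 1
  congr 1
  funext i
  simp only [Fin.contractNth, Fin.val_succ, add_lt_add_iff_right, add_left_inj]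
  rfl

lemma restFaces_ofFn (n : ℕ) (g : Fin (n + 1) → G) :
    restFaces (single (List.ofFn g) (1 : ℤ)) =
      ∑ j : Fin (n + 1), (-1 : ℤ) ^ ((j : ℕ) + 1) •
        single (List.ofFn (Fin.contractNth j (· * ·) g)) (1 : ℤ) := by
  induction n with
  | zero => simp [single_cons, restFaces_cons, headMul_nil, restFaces_nil]
  | succ n ih =>
    rw [List.ofFn_succ, single_cons, restFaces_cons, ih]
    conv_rhs => rw [Fin.sum_univ_succ]
    rw [List.ofFn_succ, single_cons, headMul_cons, contractNth_zero_ofFn]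
    simp only [contractNth_succ_ofFn, map_sum, map_smul, cons_single]
    simp [pow_succ, sub_eq_add_neg]

lemma toWord_d_succ (ω : G →* ℤˣ) (n : ℕ) (c : (Fin (n + 1) → G) →₀ ℤ) :
    toWord n (groupHomology.inhomogeneousChains.d (twistedInt ω) n c) =
      wordBoundary ω (toWord (n + 1) c) := by
  induction c using Finsupp.induction_linear with
  | zero => simp
  | add f g hf hg => simp only [map_add, hf, hg]
  | single g t =>
    have ht : single g t = t • single g (1 : ℤ) := by simp
    rw [ht]
    simp only [map_smul]
    congr 1
    rw [toWord_single, wordBoundary, LinearMap.add_apply, restFaces_ofFn, List.ofFn_succ,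
      single_cons, frontFace_cons]
    erw [groupHomology.inhomogeneousChains.d_single]
    rw [map_add, map_sum]
    congr 1
    · simp [toWord_single, twistedRepresentation, Int.units_inv_eq_self]
    · refine Finset.sum_congr rfl fun j _ => ?_
      rw [map_smul]
      congr 1
      exact toWord_single _ _

lemma wordBoundary_toWord_zero (ω : G →* ℤˣ) (c : (Fin 0 → G) →₀ ℤ) :
    wordBoundary ω (toWord 0 c) = 0 := by
  induction c using Finsupp.induction_linear with
  | zero => simp
  | add f g hf hg => simp only [map_add, hf, hg, add_zero]
  | single g t =>
    simp [toWord_single, wordBoundary, frontFace_nil, restFaces_nil]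

/-- The bar complex of `G` with coefficients in the twisted integers. -/
abbrev chains (ω : G →* ℤˣ) : ChainComplex (ModuleCat ℤ) ℕ :=
  groupHomology.inhomogeneousChains (twistedInt ω)

lemma toWord_d (ω : G →* ℤˣ) (i j : ℕ) (h : (ComplexShape.down ℕ).next i = j)
    (c : (Fin i → G) →₀ ℤ) :
    toWord j ((chains ω).d i j c) = wordBoundary ω (toWord i c) := by
  cases i with
  | zero =>
    rw [wordBoundary_toWord_zero, (chains ω).shape]
    · exact map_zero _
    · simp
  | succ n =>
    obtain rfl : n = j := by simpa using h
    have hd : (chains ω).d (n + 1) n = groupHomology.inhomogeneousChains.d (twistedInt ω) n :=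
      groupHomology.inhomogeneousChains.d_def (twistedInt ω) n
    rw [hd]
    exact toWord_d_succ ω n c

/-! ### The product on homology -/

/-- The underlying chain of a cycle. -/
def cycleChain (ω : G →* ℤˣ) (n : ℕ) :
    groupHomology.cycles (twistedInt ω) n →ₗ[ℤ] ((Fin n → G) →₀ ℤ) :=
  (groupHomology.iCycles (twistedInt ω) n).hom

/-- The homology class of a cycle. -/
def cycleClass (ω : G →* ℤˣ) (n : ℕ) : groupHomology.cycles (twistedInt ω) n →ₗ[ℤ] H ω n :=
  (groupHomology.π (twistedInt ω) n).hom

lemma cycleChain_injective (ω : G →* ℤˣ) (n : ℕ) : Function.Injective (cycleChain ω n) :=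
  (ModuleCat.mono_iff_injective (groupHomology.iCycles (twistedInt ω) n)).1 inferInstance

lemma cycleClass_surjective (ω : G →* ℤˣ) (n : ℕ) : Function.Surjective (cycleClass ω n) :=
  fun a => groupHomology_induction_on a fun x => ⟨x, rfl⟩

lemma wordBoundary_cycleChain (ω : G →* ℤˣ) (n : ℕ)
    (x : groupHomology.cycles (twistedInt ω) n) :
    wordBoundary ω (toWord n (cycleChain ω n x)) = 0 := by
  rw [← toWord_d ω n _ rfl]
  have : (chains ω).d n _ (cycleChain ω n x) = 0 :=
    congr($((chains ω).iCycles_d n ((ComplexShape.down ℕ).next n)) x)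
  rw [this]
  exact map_zero _

lemma exists_cycleChain (ω : G →* ℤˣ) (n : ℕ) (c : (Fin n → G) →₀ ℤ)
    (hc : wordBoundary ω (toWord n c) = 0) : ∃ x, cycleChain ω n x = c := by
  refine ⟨groupHomology.cyclesMk n _ rfl c ?_, groupHomology.iCycles_mk _ _ _⟩
  apply toWord_injective
  rw [toWord_d ω n _ rfl, hc]
  exact (map_zero _).symm

lemma cycleClass_eq_zero_iff (ω : G →* ℤˣ) (n : ℕ)
    (x : groupHomology.cycles (twistedInt ω) n) :
    cycleClass ω n x = 0 ↔ ∃ c : (Fin (n + 1) → G) →₀ ℤ,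
      toWord n (cycleChain ω n x) = wordBoundary ω (toWord (n + 1) c) := by
  have hex : (ShortComplex.mk _ _ ((chains ω).toCycles_comp_homologyπ (n + 1) n)).Exact :=
    ShortComplex.exact_of_g_is_cokernel _ ((chains ω).homologyIsCokernel (n + 1) n (by simp))
  have hchain (c : (Fin (n + 1) → G) →₀ ℤ) :
      toWord n (cycleChain ω n ((chains ω).toCycles (n + 1) n c)) =
        wordBoundary ω (toWord (n + 1) c) := by
    rw [← toWord_d ω (n + 1) n (by simp)]
    congr 1
    exact congr($((chains ω).toCycles_i (n + 1) n) c)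
  constructor
  · intro hx
    obtain ⟨c, hc⟩ := (ShortComplex.moduleCat_exact_iff _).1 hex x hx
    exact ⟨c, by rw [← hchain]; exact congrArg (fun z => toWord n (cycleChain ω n z)) hc.symm⟩
  · rintro ⟨c, hc⟩
    rw [← hchain] at hc
    obtain rfl := cycleChain_injective ω n (toWord_injective n hc)
    exact congr($((chains ω).toCycles_comp_homologyπ (n + 1) n) c)

lemma exists_cycleMul (ω : G →* ℤˣ) {m n k : ℕ} (h : m + n = k)
    (x : groupHomology.cycles (twistedInt ω) m) (y : groupHomology.cycles (twistedInt ω) n) :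
    ∃ z, cycleChain ω k z = chainMul m n k (cycleChain ω m x) (cycleChain ω n y) := by
  apply exists_cycleChain
  rw [toWord_chainMul h, wordBoundary_wordMul, wordBoundary_cycleChain, wordBoundary_cycleChain]
  simp

/-- The shuffle product of cycles. -/
def cycleMul (ω : G →* ℤˣ) {m n k : ℕ} (h : m + n = k)
    (x : groupHomology.cycles (twistedInt ω) m) (y : groupHomology.cycles (twistedInt ω) n) :
    groupHomology.cycles (twistedInt ω) k :=
  (exists_cycleMul ω h x y).choose

lemma cycleChain_cycleMul (ω : G →* ℤˣ) {m n k : ℕ} (h : m + n = k)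
    (x : groupHomology.cycles (twistedInt ω) m) (y : groupHomology.cycles (twistedInt ω) n) :
    cycleChain ω k (cycleMul ω h x y) =
      chainMul m n k (cycleChain ω m x) (cycleChain ω n y) :=
  (exists_cycleMul ω h x y).choose_spec

lemma cycleMul_add_left (ω : G →* ℤˣ) {m n k : ℕ} (h : m + n = k)
    (x x' : groupHomology.cycles (twistedInt ω) m) (y : groupHomology.cycles (twistedInt ω) n) :
    cycleMul ω h (x + x') y = cycleMul ω h x y + cycleMul ω h x' y :=
  cycleChain_injective ω k (by simp only [cycleChain_cycleMul, map_add, LinearMap.add_apply])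

lemma cycleMul_add_right (ω : G →* ℤˣ) {m n k : ℕ} (h : m + n = k)
    (x : groupHomology.cycles (twistedInt ω) m) (y y' : groupHomology.cycles (twistedInt ω) n) :
    cycleMul ω h x (y + y') = cycleMul ω h x y + cycleMul ω h x y' :=
  cycleChain_injective ω k (by simp only [cycleChain_cycleMul, map_add])

lemma cycleClass_cycleMul_left (ω : G →* ℤˣ) {m n k : ℕ} (h : m + n = k)
    (x : groupHomology.cycles (twistedInt ω) m) (y : groupHomology.cycles (twistedInt ω) n)
    (hx : cycleClass ω m x = 0) : cycleClass ω k (cycleMul ω h x y) = 0 := by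
  obtain ⟨c, hc⟩ := (cycleClass_eq_zero_iff ω m x).1 hx
  refine (cycleClass_eq_zero_iff ω k _).2 ⟨chainMul (m + 1) n (k + 1) c (cycleChain ω n y), ?_⟩
  rw [cycleChain_cycleMul, toWord_chainMul h, toWord_chainMul (by omega), wordBoundary_wordMul,
    wordBoundary_cycleChain, hc]
  simp

lemma cycleClass_cycleMul_right (ω : G →* ℤˣ) {m n k : ℕ} (h : m + n = k)
    (x : groupHomology.cycles (twistedInt ω) m) (y : groupHomology.cycles (twistedInt ω) n)
    (hy : cycleClass ω n y = 0) : cycleClass ω k (cycleMul ω h x y) = 0 := by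
  obtain ⟨c, hc⟩ := (cycleClass_eq_zero_iff ω n y).1 hy
  refine (cycleClass_eq_zero_iff ω k _).2
    ⟨(-1 : ℤ) ^ m • chainMul m (n + 1) (k + 1) (cycleChain ω m x) c, ?_⟩
  have hs : (-1 : ℤ) ^ m * (-1 : ℤ) ^ m = 1 := by rw [← mul_pow]; simp
  rw [cycleChain_cycleMul, toWord_chainMul h, map_smul, toWord_chainMul (by omega), map_smul,
    wordBoundary_wordMul, wordBoundary_cycleChain, hc, degSign_toWord, map_zero,
    LinearMap.zero_apply, zero_add, map_smul, LinearMap.smul_apply, smul_smul, hs, one_smul]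

/-- The class of a shuffle product of cycles depends only on the classes of the factors. -/
lemma cycleClass_cycleMul_congr (ω : G →* ℤˣ) {m n k : ℕ} (h : m + n = k)
    {x x' : groupHomology.cycles (twistedInt ω) m} {y y' : groupHomology.cycles (twistedInt ω) n}
    (hx : cycleClass ω m x = cycleClass ω m x') (hy : cycleClass ω n y = cycleClass ω n y') :
    cycleClass ω k (cycleMul ω h x y) = cycleClass ω k (cycleMul ω h x' y') := by
  have h1 : cycleMul ω h x y = cycleMul ω h (x - x') y + cycleMul ω h x' y := by
    rw [← cycleMul_add_left, sub_add_cancel]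
  have h2 : cycleMul ω h x' y = cycleMul ω h x' (y - y') + cycleMul ω h x' y' := by
    rw [← cycleMul_add_right, sub_add_cancel]
  rw [h1, h2, map_add, map_add,
    cycleClass_cycleMul_left ω h _ _ (by rw [map_sub, hx, sub_self]),
    cycleClass_cycleMul_right ω h _ _ (by rw [map_sub, hy, sub_self]), zero_add, zero_add]

/-- The Pontryagin product `H_m(G; ℤ̃) × H_n(G; ℤ̃) → H_k(G; ℤ̃)`, where `k = m + n`: the product
on homology induced by the shuffle product of the bar complex. It is computed on arbitrary
cycles representing the two classes. -/
def product (ω : G →* ℤˣ) {m n k : ℕ} (h : m + n = k) (a : H ω m) (b : H ω n) : H ω k :=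
  cycleClass ω k (cycleMul ω h (Function.surjInv (cycleClass_surjective ω m) a)
    (Function.surjInv (cycleClass_surjective ω n) b))

/-- The product of the classes of two cycles is the class of their shuffle product. -/
lemma product_cycleClass (ω : G →* ℤˣ) {m n k : ℕ} (h : m + n = k)
    (x : groupHomology.cycles (twistedInt ω) m) (y : groupHomology.cycles (twistedInt ω) n) :
    product ω h (cycleClass ω m x) (cycleClass ω n y) = cycleClass ω k (cycleMul ω h x y) :=
  cycleClass_cycleMul_congr ω h (Function.surjInv_eq _ _) (Function.surjInv_eq _ _)

end Pontryagin

end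

noncomputable section

namespace Pontryagin

open Finsupp

/-! ### Commutativity and squares for words and chains -/

variable {G : Type} [CommGroup G]

/-! All three claims already hold for chains, before passing to homology. The shuffle product does
not involve `ω`, which enters only through the boundary. Exchanging the two words permutes the
shuffles and multiplies each sign by (-1)^(mn) (`shuffle_comm`). For odd n this gives c ∧ c = -(c ∧
c), so the square vanishes, the chain group being free abelian.

For even n > 0, the shuffles of a word with itself split by which copy supplies the first letter,
and the two halves are equal (`two_dvd_shuffle_self`). The empty word has no first letter, hence n >
0. The cross terms of a general chain double by commutativity, so c ∧ c = 2e
(`two_dvd_chainMul_self`). If c is a cycle, then 2∂e = 0, so e is a cycle, and its class is the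
required half. -/

/-- The shuffle product of bar generators is graded commutative. -/
lemma shuffle_comm (x y : List G) :
    shuffle x y = (-1 : ℤ) ^ (x.length * y.length) • shuffle y x := by
  induction x, y using shuffle.induct with
  | case1 y => simp [shuffle_nil_left, shuffle_nil_right]
  | case2 a x => simp [shuffle_nil_left, shuffle_nil_right]
  | case3 a x b y ih1 ih2 =>
    have h : (-1 : ℤ) ^ (y.length * 2) = 1 := by simp [pow_mul']
    -- The right side lists the shuffles starting with `b` first; `add_comm` aligns the two sums.
    rw [shuffle_cons_cons, shuffle_cons_cons, ih1, ih2, add_comm]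
    simp only [map_smul, smul_add, smul_smul, List.length_cons, ← pow_add]
    congr 2
    · congr 1; ring
    -- Moving `a` past `b :: y` is counted twice, in the global sign and in the recursion, so the
    -- exponents differ by the even number 2(|y| + 1).
    · rw [show (x.length + 1) * (y.length + 1) + (y.length + 1)
        = x.length * (y.length + 1) + y.length * 2 + 2 by ring, pow_add, pow_add, h]
      simp

/-- The shuffle square of a bar generator of positive even degree is divisible by two. -/
lemma two_dvd_shuffle_self {x : List G} (hx : x ≠ []) (he : Even x.length) :
    ∃ z, shuffle x x = (2 : ℤ) • z := by
  obtain ⟨a, x, rfl⟩ := List.exists_cons_of_ne_nil hx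
  -- The witness collects the shuffles whose first letter comes from the first copy. The other half
  -- agrees with it: |x|(|x| + 1) and |x| + 1 are both even, so both signs are +1.
  refine ⟨cons a (shuffle x (a :: x)), ?_⟩
  rw [shuffle_cons_cons, shuffle_comm (a :: x) x, (he.mul_right _).neg_one_pow, two_smul,
    show x.length + 1 = (a :: x).length from rfl, he.neg_one_pow, one_smul, one_smul]

/-- The shuffle product of chains is graded commutative. -/
lemma chainMul_comm (m n k : ℕ) (c : (Fin m → G) →₀ ℤ) (d : (Fin n → G) →₀ ℤ) :
    chainMul m n k c d = (-1 : ℤ) ^ (m * n) • chainMul n m k d c := by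
  induction c using Finsupp.induction_linear with
  | zero => simp
  | add f g hf hg => simp only [map_add, LinearMap.add_apply, smul_add, hf, hg]
  | single g s =>
    induction d using Finsupp.induction_linear with
    | zero => simp
    | add f g hf hg => simp only [map_add, LinearMap.add_apply, smul_add, hf, hg]
    | single g' t =>
      simp only [chainMul, LinearMap.compr₂_apply, LinearMap.compl₁₂_apply, toWord_single,
        wordMul_single]
      rw [shuffle_comm, List.length_ofFn, List.length_ofFn, smul_comm, map_smul, mul_comm s t]

/-- The shuffle square of a chain of odd degree vanishes. -/
lemma chainMul_self_of_odd {n : ℕ} (hn : Odd n) (k : ℕ) (c : (Fin n → G) →₀ ℤ) :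
    chainMul n n k c c = 0 := by
  have h := chainMul_comm n n k c c
  -- Absence of 2-torsion in the chains is used here; in homology, 2u = 0 would not give u = 0.
  rwa [(hn.mul hn).neg_one_pow, neg_one_smul, self_eq_neg] at h

/-- The shuffle square of a chain of positive even degree is divisible by two. -/
lemma two_dvd_chainMul_self {n : ℕ} (hpos : 0 < n) (hn : Even n) (k : ℕ)
    (c : (Fin n → G) →₀ ℤ) : ∃ e, chainMul n n k c c = (2 : ℤ) • e := by
  induction c using Finsupp.induction_linear with
  | zero => exact ⟨0, by simp⟩
  | add f g hf hg =>
    obtain ⟨u, hu⟩ := hf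
    obtain ⟨v, hv⟩ := hg
    -- Polarization: the cross terms fg and gf coincide in even degree, so one of them goes into the
    -- half.
    refine ⟨u + chainMul n n k f g + v, ?_⟩
    simp only [map_add, LinearMap.add_apply]
    rw [hu, hv, chainMul_comm n n k g f,
      (hn.mul_right n).neg_one_pow, one_smul]
    simp only [smul_add, two_smul]
    abel
  | single g t =>
    have hlen : (List.ofFn g).length = n := List.length_ofFn
    obtain ⟨z, hz⟩ := two_dvd_shuffle_self (x := List.ofFn g)
      (List.ne_nil_of_length_pos (hlen.symm ▸ hpos)) (hlen.symm ▸ hn)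
    -- Linearity of `ofWord k` suffices: neither the degree of `z` nor a relation between `k` and
    -- `n` matters.
    refine ⟨ofWord k ((t * t) • z), ?_⟩
    simp only [chainMul, LinearMap.compr₂_apply, LinearMap.compl₁₂_apply, toWord_single,
      wordMul_single]
    rw [hz, smul_comm, map_smul]

/-! ### Passage to homology -/

variable (ω : G →* ℤˣ)

/-- The Pontryagin product is graded commutative. -/
theorem product_comm {m n k : ℕ} (hmn : m + n = k) (hnm : n + m = k) (a : H ω m) (b : H ω n) :
    product ω hmn a b = (-1 : ℤ) ^ (m * n) • product ω hnm b a := by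
  obtain ⟨x, rfl⟩ := cycleClass_surjective ω m a
  obtain ⟨y, rfl⟩ := cycleClass_surjective ω n b
  rw [product_cycleClass, product_cycleClass, ← map_zsmul]
  -- The representing cycles are themselves equal, with no boundary as correction.
  congr 1
  apply cycleChain_injective ω k
  rw [map_zsmul, cycleChain_cycleMul, cycleChain_cycleMul, chainMul_comm]

/-- The Pontryagin square of a class of odd degree vanishes. -/
theorem product_self_of_odd {n k : ℕ} (h : n + n = k) (hn : Odd n) (a : H ω n) :
    product ω h a a = 0 := by
  obtain ⟨x, rfl⟩ := cycleClass_surjective ω n a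
  rw [product_cycleClass, show cycleMul ω h x x = 0 from
    cycleChain_injective ω k (by rw [cycleChain_cycleMul, chainMul_self_of_odd hn, map_zero]),
    map_zero]

/-- The Pontryagin square of a class of positive even degree is divisible by two. Half of the
shuffle square of a cycle is again a cycle because the bar complex is torsion-free. -/
theorem two_dvd_product_self {n k : ℕ} (h : n + n = k) (hpos : 0 < n) (hn : Even n)
    (a : H ω n) : ∃ b : H ω k, product ω h a a = (2 : ℤ) • b := by
  obtain ⟨x, rfl⟩ := cycleClass_surjective ω n a
  obtain ⟨e, he⟩ := two_dvd_chainMul_self hpos hn k (cycleChain ω n x)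
  have hcycle : wordBoundary ω (toWord k e) = 0 := by
    -- Twice `e` is the chain of the cycle `cycleMul ω h x x`.
    have h2 : (2 : ℤ) • wordBoundary ω (toWord k e) = 0 := by
      rw [← map_smul, ← map_smul, ← he, ← cycleChain_cycleMul ω h, wordBoundary_cycleChain]
    exact (smul_eq_zero.1 h2).resolve_left two_ne_zero
  obtain ⟨z, hz⟩ := exists_cycleChain ω k e hcycle
  refine ⟨cycleClass ω k z, ?_⟩
  rw [product_cycleClass, ← map_zsmul]
  congr 1
  apply cycleChain_injective ω k
  rw [map_zsmul, cycleChain_cycleMul, he, hz]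

end Pontryagin

end

/-- The target degree is a variable `k` with proofs of m + n = k and n + m = k, so both products lie
in the same type and no transport is needed. -/
theorem corollary3p3 {ι : Type} [Finite ι] (G : ι → Type) [∀ i, CommGroup (G i)]
    (hcyclic : ∀ i, IsCyclic (G i))
    (hprimary : ∀ i, Infinite (G i) ∨ IsPrimePow (Nat.card (G i)))
    (ω : (∀ i, G i) →* ℤˣ) :
    (∀ (m n k : ℕ) (hmn : m + n = k) (hnm : n + m = k)
      (a : Pontryagin.H ω m) (b : Pontryagin.H ω n),
      Pontryagin.product ω hmn a b = (-1 : ℤ) ^ (m * n) • Pontryagin.product ω hnm b a) ∧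
    (∀ (n k : ℕ) (h : n + n = k), Odd n → ∀ a : Pontryagin.H ω n,
      Pontryagin.product ω h a a = 0) ∧
    (∀ (n k : ℕ) (h : n + n = k), 0 < n → Even n → ∀ a : Pontryagin.H ω n,
      ∃ b : Pontryagin.H ω k, Pontryagin.product ω h a a = (2 : ℤ) • b) :=
  ⟨fun _ _ _ hmn hnm => Pontryagin.product_comm ω hmn hnm,
    fun _ _ h => Pontryagin.product_self_of_odd ω h,
    fun _ _ h => Pontryagin.two_dvd_product_self ω h⟩
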